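/- Let $m,t\ge 1$ and $0\le s_{\min}\le s_{\max}\le m-t$ be integers with $s_{\max}\ge 1$, and put $S=[s_{\min}:s_{\max}]$. In the decentralized complete-$S$ PICOD$(t)$ there are $m$ independent messages $w_1,\dots,w_m$, each uniform on $\{0,1\}^\kappa$, and one user for every set $A\subseteq[m]$ with $|A|\in S$. The user with set $A$ knows $(w_a)_{a\in A}$ as side information. There is no other transmitter. A code consists of an integer $\kappa\ge 1$; for every user $j$, with side information set $A_j$, an encoder that maps $(w_a)_{a\in A_j}$ to $b_j$ bits, which are broadcast without error to all the users; a set $D_j\subseteq[m]\setminus A_j$ with $|D_j|=t$, chosen freely by the code but not depending on the values of the messages; and a decoder that maps $(w_a)_{a\in A_j}$ and all the broadcast bits to an estimate of $(w_d)_{d\in D_j}$. Its code-length is $\ell=\frac1\kappa\sum_j b_j$. A number $\ell$ is achievable if for every $\varepsilon>0$ there is a code, for some $\kappa$, of code-length $\ell$ in which each user's estimate is wrong with probability at most $\varepsilon$; it is achievable with zero error if some code of code-length $\ell$ has all the estimates always correct. Then the smallest achievable $\ell$ and the smallest $\ell$ achievable with zero error both exist and are both equal to $$\ell^\star=\begin{cases}\dfrac{\binom{m}{m-t}}{\binom{m}{m-t}-1}\,t,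 & s_{\min}=s_{\max}=m-t,\\[2ex] \min\{s_{\max}+t,\;m-s_{\min}\}, & \text{otherwise.}\end{cases}$$ -/

import Mathlib

/-- A message of `κ` bits. -/
abbrev PICOD.Msg (κ : ℕ) : Type := Fin κ → Bool

/-- A code for the decentralized pliable index coding problem `PICOD(t)` with `m` messages, users
indexed by `ι`, and side information sets `A j ⊆ {1, …, m}` (`j : ι`).  The side information sets
and the code are known to all the users. -/
structure PICOD.Code {m : ℕ} {ι : Type} (A : ι → Finset (Fin m)) (t : ℕ) where
  /-- the number of bits of every message -/
  κ : ℕ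
  κ_pos : 0 < κ
  /-- the number of bits broadcast by each user -/
  bits : ι → ℕ
  /-- user `j` broadcasts a function of the messages in its own side information set only -/
  enc : (j : ι) → (A j → PICOD.Msg κ) → (Fin (bits j) → Bool)
  /-- the indices of the desired messages of each user -/
  D : ι → Finset (Fin m)
  D_card : ∀ j, (D j).card = t
  D_disjoint : ∀ j, Disjoint (D j) (A j)
  /-- user `j` estimates its desired messages from its side information and from everything that
  has been broadcast -/
  dec : (j : ι) → (A j → PICOD.Msg κ) → ((i : ι) → Fin (bits i) → Bool) → (D j → PICOD.Msg κ)

namespace PICOD.Code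

variable {m : ℕ} {ι : Type} {A : ι → Finset (Fin m)} {t : ℕ}

/-- The overall codeword when the messages are `w`. -/
def codeword (c : PICOD.Code A t) (w : Fin m → PICOD.Msg c.κ) (i : ι) : Fin (c.bits i) → Bool :=
  c.enc i (fun a : A i => w a.1)

/-- User `j` recovers its desired messages when the messages are `w`. -/
def Correct (c : PICOD.Code A t) (j : ι) (w : Fin m → PICOD.Msg c.κ) : Prop :=
  c.dec j (fun a : A j => w a.1) (c.codeword w) = fun d : c.D j => w d.1

open Classical in
/-- The probability that user `j` fails to recover its desired messages, the `m` messages being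
independent and uniform on `κ` bits, that is, `w` being uniform on all the message tuples. -/
noncomputable def errorProb (c : PICOD.Code A t) (j : ι) : ℝ :=
  ((Finset.univ.filter fun w : Fin m → PICOD.Msg c.κ => ¬ c.Correct j w).card : ℝ) /
    Fintype.card (Fin m → PICOD.Msg c.κ)

/-- The code-length: the total number of broadcast bits in units of messages. -/
noncomputable def length [Fintype ι] (c : PICOD.Code A t) : ℝ :=
  ((∑ j, c.bits j : ℕ) : ℝ) / c.κ

end PICOD.Code

/-- The code-length `ℓ` is achievable with vanishing error probability: for every `ε > 0` there is
a code of length `ℓ` (for some number `κ` of bits per message) such that every user fails to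
recover its desired messages with probability at most `ε`. -/
def PICOD.Achievable {m : ℕ} {ι : Type} [Fintype ι] (A : ι → Finset (Fin m)) (t : ℕ) (ℓ : ℝ) :
    Prop :=
  ∀ ε : ℝ, 0 < ε → ∃ c : PICOD.Code A t, c.length = ℓ ∧ ∀ j, c.errorProb j ≤ ε

/-- The code-length `ℓ` is achievable with zero error. -/
def PICOD.ZeroErrorAchievable {m : ℕ} {ι : Type} [Fintype ι] (A : ι → Finset (Fin m)) (t : ℕ)
    (ℓ : ℝ) : Prop :=
  ∃ c : PICOD.Code A t, c.length = ℓ ∧ ∀ j w, c.Correct j w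

/-- The side information sets of the complete-`S` system: one user for each set of messages whose
size is in `S`. -/
def PICOD.completeSideInfo (m : ℕ) (S : Finset ℕ) :
    {B : Finset (Fin m) // B.card ∈ S} → Finset (Fin m) :=
  fun B => B.1

/-! Converse. For fixed desired sets, knowing a user's side information and the codeword yields its
desired messages; this defines a closure operator on sets of messages. If `cl P` exceeds `P` by `k`
elements, revealing `P` and the complement of `cl P` lets the codeword determine everything, so the
length is at least `k`. In the complete-`S` system no closed set has size in `[smin, smax + t)`.
`ClosureOperator.exists_card_add_le_card` turns this gap into a `P` with `k = min (smax + t) (m -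
smin)`: otherwise an intersection of closures, chosen by a bipartite-graph lemma, would be a closed
set with size in the gap.

When `smin = smax = m - t`, a sharper count is available: a user's own bits are useless to it, so
the bits of all the others must carry its `t` missing messages. Summing over the users gives the
factor `N / (N - 1)`, with `N` the number of users.

Achievability. Outside the exceptional case, a systematic MDS code works, on a set of messages
chosen so that each transmission can be formed by some user. In the exceptional case, messages are
split into `N - 1` symbols and every user sends `t` generic combinations of all the symbols it
knows; Hall's theorem and a nonvanishing determinant give decodability. -/

/-! ### Closure operators whose closed sets avoid an interval of sizes -/

/-- In a bipartite graph with more left than right vertices, some nonempty set `J` of left vertices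
has exactly `|J| - 1` common neighbours. -/
theorem exists_card_commonNeighbors_add_one {α β : Type*} [DecidableEq α] [DecidableEq β]
    (r : α → β → Prop) [∀ x z, Decidable (r x z)] (X : Finset α) (Z : Finset β)
    (h : Z.card < X.card) :
    ∃ J ⊆ X, J.Nonempty ∧ (Z.filter fun z => ∀ x ∈ J, r x z).card + 1 = J.card := by
  induction hn : X.card using Nat.strong_induction_on generalizing X Z with
  | _ n ih =>
  by_cases h0 : ∃ x ∈ X, Z.filter (r x) = ∅
  · obtain ⟨x, hx, hx0⟩ := h0
    refine ⟨{x}, by simpa using hx, by simp, ?_⟩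
    simp [hx0]
  push Not at h0
  -- If `deg z ≤ deg x` on every edge, summing `1 / deg x ≤ 1 / deg z` over the edges would give
  -- `|X| ≤ |Z|`.
  have hedge : ∃ x ∈ X, ∃ z ∈ Z, r x z ∧
      (Z.filter (r x)).card < (X.filter fun y => r y z).card := by
    by_contra! hcon
    have h1 : (X.card : ℚ) ≤ Z.card := by
      calc (X.card : ℚ) = ∑ x ∈ X, ∑ z ∈ Z.filter (r x), ((Z.filter (r x)).card : ℚ)⁻¹ := by
            rw [Finset.card_eq_sum_ones, Nat.cast_sum]
            refine Finset.sum_congr rfl fun x hx => ?_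
            have : ((Z.filter (r x)).card : ℚ) ≠ 0 := by
              simpa using (Finset.nonempty_iff_ne_empty.1 (h0 x hx))
            rw [Finset.sum_const, nsmul_eq_mul, mul_inv_cancel₀ this, Nat.cast_one]
        _ ≤ ∑ x ∈ X, ∑ z ∈ Z.filter (r x), ((X.filter fun y => r y z).card : ℚ)⁻¹ := by
            refine Finset.sum_le_sum fun x hx => Finset.sum_le_sum fun z hz => ?_
            rw [Finset.mem_filter] at hz
            have hpos : 0 < (X.filter fun y => r y z).card :=
              Finset.card_pos.2 ⟨x, by simp [hx, hz.2]⟩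
            have := hcon x hx z hz.1 hz.2
            gcongr
        _ = ∑ z ∈ Z, ∑ x ∈ X.filter (fun y => r y z), ((X.filter fun y => r y z).card : ℚ)⁻¹ := by
            refine Finset.sum_comm' fun x z => ?_
            simp only [Finset.mem_filter]
            tauto
        _ ≤ ∑ z ∈ Z, 1 := by
            refine Finset.sum_le_sum fun z _ => ?_
            rw [Finset.sum_const, nsmul_eq_mul]
            exact mul_inv_le_one
        _ = Z.card := by simp
    have : X.card ≤ Z.card := by exact_mod_cast h1
    omega
  obtain ⟨x, hx, z, hz, hxz, hlt⟩ := hedge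
  have hxm : x ∈ X.filter fun y => r y z := by simp [hx, hxz]
  have hzm : z ∈ Z.filter (r x) := by simp [hz, hxz]
  have hX := Finset.card_erase_add_one hxm
  have hZ := Finset.card_erase_add_one hzm
  have hle : (X.filter fun y => r y z).card ≤ X.card := Finset.card_filter_le _ _
  -- Recurse on the neighbours of `z` other than `x` against those of `x` other than `z`. Adding `x`
  -- to `J` then restores exactly `z` as a common neighbour, so both counts grow by one.
  obtain ⟨J, hJ, -, hJc⟩ := ih ((X.filter fun y => r y z).erase x).card (by omega)
    ((X.filter fun y => r y z).erase x) ((Z.filter (r x)).erase z) (by omega) rfl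
  have hxJ : x ∉ J := fun hm => by simpa using hJ hm
  have hrJ : ∀ y ∈ J, y ∈ X ∧ r y z := fun y hy => by
    have := hJ hy
    simp only [Finset.mem_erase, Finset.mem_filter] at this
    exact this.2
  refine ⟨insert x J, ?_, by simp, ?_⟩
  · intro y hy
    rcases Finset.mem_insert.1 hy with rfl | hy
    exacts [hx, (hrJ y hy).1]
  · rw [Finset.card_insert_of_notMem hxJ, ← hJc]
    congr 1
    rw [← Finset.card_insert_of_notMem (a := z)]
    · congr 1
      ext u
      simp only [Finset.mem_filter, Finset.mem_insert, Finset.mem_erase, forall_eq_or_imp]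
      constructor
      · rintro ⟨hu, hxu, hJu⟩
        by_cases huz : u = z
        exacts [Or.inl huz, Or.inr ⟨⟨huz, hu, hxu⟩, hJu⟩]
      · rintro (rfl | ⟨⟨-, hu, hxu⟩, hJu⟩)
        exacts [⟨hz, hxz, fun y hy => (hrJ y hy).2⟩, ⟨hu, hxu, hJu⟩]
    · simp

/-- A closure operator whose closed sets all have fewer than `a` or at least `b` elements admits
a set whose closure adds at least `min b (|α| - a)` elements. -/
theorem ClosureOperator.exists_card_add_le_card {α : Type*} [Fintype α] [DecidableEq α]
    (cl : ClosureOperator (Finset α)) (a b : ℕ) (hab : a < b)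
    (hgap : ∀ Q, cl Q = Q → Q.card < a ∨ b ≤ Q.card) :
    ∃ P, P.card + min b (Fintype.card α - a) ≤ (cl P).card := by
  by_contra! hcon
  -- A minimal generating set is irredundant, and so is each of its subsets; an `X` of size `a + 1`
  -- is taken inside it.
  obtain ⟨R, hR, hRmin⟩ := (Finset.univ.filter fun R => cl R = Finset.univ).exists_minimal
    ⟨Finset.univ, by simpa using Finset.univ_subset_iff.1 (cl.le_closure _)⟩
  simp only [Finset.mem_filter, Finset.mem_univ, true_and] at hR hRmin
  have hRcard : a + 1 ≤ R.card := by
    have := hcon R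
    rw [hR, Finset.card_univ] at this
    have := Finset.card_le_univ R
    omega
  obtain ⟨X, hXR, hXcard⟩ := Finset.exists_subset_card_eq hRcard
  have hirr : ∀ x ∈ X, x ∉ cl (X.erase x) := by
    intro x hx hmem
    have h1 : R ⊆ cl (R.erase x) := by
      intro y hy
      by_cases hyx : y = x
      · subst hyx
        exact cl.monotone (Finset.erase_subset_erase _ hXR) hmem
      · exact cl.le_closure _ (Finset.mem_erase.2 ⟨hyx, hy⟩)
    have h2 : cl (R.erase x) = Finset.univ := by
      apply Finset.univ_subset_iff.1
      rw [← hR]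
      have := cl.monotone h1
      rwa [cl.idempotent] at this
    have h3 := hRmin h2 (Finset.erase_subset _ _) (hXR hx)
    simp at h3
  have hXcl : X ⊆ cl X := cl.le_closure X
  have hZcard : (cl X \ X).card < b := by
    have := hcon X
    have := Finset.card_sdiff_add_card_eq_card hXcl
    omega
  -- At most `a` elements keep `Z` smaller than `X`, while fewer than `b - a` elements of `cl X \ X`
  -- are left out.
  obtain ⟨Z, hZ, hZle, hZge⟩ : ∃ Z ⊆ cl X \ X, Z.card ≤ a ∧ (cl X \ X).card + a < Z.card + b := by
    rcases le_total (cl X \ X).card a with h | h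
    · exact ⟨_, subset_rfl, h, by omega⟩
    · obtain ⟨Z, hZ, hc⟩ := Finset.exists_subset_card_eq h
      exact ⟨Z, hZ, hc.le, by omega⟩
  obtain ⟨J, hJX, ⟨x₀, hx₀⟩, hJ⟩ := exists_card_commonNeighbors_add_one
    (fun x z => z ∈ cl (X.erase x)) X Z (by omega)
  replace hJ : (Z.filter fun z => ∀ x ∈ J, z ∈ cl (X.erase x)).card + 1 = J.card := by
    convert hJ
  -- An intersection of closed sets. It has `a + 1 - |J|` elements in `X`, `|J| - 1` in `Z` and
  -- fewer than `b - a` elsewhere, so its size lies in `[a, b)`.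
  set Q : Finset α := (cl X).filter fun z => ∀ x ∈ J, z ∈ cl (X.erase x) with hQ
  have hQclosed : cl Q = Q := by
    refine le_antisymm (fun z hz => ?_) (cl.le_closure Q)
    have hsub : ∀ x ∈ J, Q ≤ cl (X.erase x) := fun x hx y hy => (Finset.mem_filter.1 hy).2 x hx
    have hsub' : ∀ x ∈ J, z ∈ cl (X.erase x) := fun x hx => by
      have := cl.monotone (hsub x hx)
      rw [cl.idempotent] at this
      exact this hz
    exact Finset.mem_filter.2
      ⟨cl.monotone (Finset.erase_subset _ _) (hsub' x₀ hx₀), hsub'⟩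
  have hQX : Q ∩ X = X \ J := by
    ext y
    simp only [hQ, Finset.mem_inter, Finset.mem_filter, Finset.mem_sdiff]
    constructor
    · rintro ⟨⟨-, hy⟩, hyX⟩
      exact ⟨hyX, fun hyJ => hirr y hyX (hy y hyJ)⟩
    · rintro ⟨hyX, hyJ⟩
      exact ⟨⟨hXcl hyX, fun x hx => cl.le_closure _
        (Finset.mem_erase.2 ⟨fun h => hyJ (h ▸ hx), hyX⟩)⟩, hyX⟩
  have h1 := Finset.card_sdiff_add_card_inter Q X
  rw [hQX] at h1
  have h2 := Finset.card_sdiff_add_card_eq_card hJX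
  have h3 : (Z.filter fun z => ∀ x ∈ J, z ∈ cl (X.erase x)).card ≤ (Q \ X).card := by
    refine Finset.card_le_card fun z hz => ?_
    have hz' := Finset.mem_filter.1 hz
    have := Finset.mem_sdiff.1 (hZ hz'.1)
    exact Finset.mem_sdiff.2 ⟨Finset.mem_filter.2 ⟨this.1, hz'.2⟩, this.2⟩
  have h4 : (Q \ X).card ≤
      (Z.filter fun z => ∀ x ∈ J, z ∈ cl (X.erase x)).card + ((cl X \ X) \ Z).card := by
    refine (Finset.card_le_card fun z hz => ?_).trans (Finset.card_union_le _ _)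
    simp only [hQ, Finset.mem_sdiff, Finset.mem_filter, Finset.mem_union] at hz ⊢
    tauto
  have h5 := Finset.card_sdiff_add_card_eq_card hZ
  rcases hgap Q hQclosed with h | h <;> omega

/-! ### Converse bounds: decoding closure and counting -/

/-- The closure of a set of messages under decoding: a user whose side information is known
contributes its desired messages. -/
noncomputable def PICOD.decodingClosure {m : ℕ} {ι : Type} (A D : ι → Finset (Fin m)) :
    ClosureOperator (Finset (Fin m)) :=
  open Classical in
  ClosureOperator.mk'
    (fun P => Finset.univ.filter fun x =>
      ∀ Q : Finset (Fin m), (∀ j, A j ⊆ Q → D j ⊆ Q) → P ⊆ Q → x ∈ Q)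
    (fun P P' h x hx => by
      simp only [Finset.mem_filter, Finset.mem_univ, true_and] at hx ⊢
      exact fun Q hQ hP => hx Q hQ (h.trans hP))
    (fun P x hx => by
      simp only [Finset.mem_filter, Finset.mem_univ, true_and]
      exact fun Q _ hP => hP hx)
    (fun P x hx => by
      simp only [Finset.mem_filter, Finset.mem_univ, true_and] at hx ⊢
      intro Q hQ hP
      refine hx Q hQ fun y hy => ?_
      simp only [Finset.mem_filter, Finset.mem_univ, true_and] at hy
      exact hy Q hQ hP)

theorem PICOD.mem_decodingClosure {m : ℕ} {ι : Type} {A D : ι → Finset (Fin m)}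
    {P : Finset (Fin m)} {x : Fin m} :
    x ∈ PICOD.decodingClosure A D P ↔
      ∀ Q : Finset (Fin m), (∀ j, A j ⊆ Q → D j ⊆ Q) → P ⊆ Q → x ∈ Q := by
  classical
  change x ∈ Finset.univ.filter _ ↔ _
  simp

theorem PICOD.subset_of_decodingClosure_eq {m : ℕ} {ι : Type} {A D : ι → Finset (Fin m)}
    {P : Finset (Fin m)} (hP : PICOD.decodingClosure A D P = P) {j : ι} (hj : A j ⊆ P) :
    D j ⊆ P := by
  intro x hx
  rw [← hP, PICOD.mem_decodingClosure]
  exact fun Q hQ hPQ => hQ j (hj.trans hPQ) hx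

namespace PICOD.Code

variable {m : ℕ} {ι : Type} {A : ι → Finset (Fin m)} {t : ℕ}

theorem Correct.eq_of_eq {c : PICOD.Code A t} {j : ι} {w w' : Fin m → PICOD.Msg c.κ}
    (h : c.Correct j w) (h' : c.Correct j w') (hA : ∀ a ∈ A j, w a = w' a)
    (hc : c.codeword w = c.codeword w') : ∀ d ∈ c.D j, w d = w' d := by
  intro d hd
  have h1 : (fun a : A j => w a.1) = fun a : A j => w' a.1 := funext fun a => hA a.1 a.2
  unfold Correct at h h'
  rw [h1, hc, h'] at h
  exact (congrFun h ⟨d, hd⟩).symm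

theorem codeword_eq_of_eq (c : PICOD.Code A t) {j : ι} {w w' : Fin m → PICOD.Msg c.κ}
    (hA : ∀ a ∈ A j, w a = w' a) : c.codeword w j = c.codeword w' j := by
  unfold codeword
  congr 1
  exact funext fun a => hA a.1 a.2

/-- If the messages with indices in `T` and the bits broadcast by the users in `I` determine all
the messages, as long as the users in `U` are correct, then they amount to at least `κ m` bits. -/
theorem kappa_mul_le_of_determined (c : PICOD.Code A t) (U I : Finset ι) (T : Finset (Fin m))
    (herr : ∑ j ∈ U, c.errorProb j < 1 / 2)
    (hdet : ∀ w w', (∀ j ∈ U, c.Correct j w) → (∀ j ∈ U, c.Correct j w') →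
      (∀ a ∈ T, w a = w' a) → (∀ i ∈ I, c.codeword w i = c.codeword w' i) → w = w') :
    c.κ * m ≤ c.κ * T.card + ∑ i ∈ I, c.bits i := by
  classical
  set G : Finset (Fin m → PICOD.Msg c.κ) := Finset.univ.filter fun w => ∀ j ∈ U, c.Correct j w
    with hG
  have hcardΩ : Fintype.card (Fin m → PICOD.Msg c.κ) = 2 ^ (c.κ * m) := by
    simp [PICOD.Msg, pow_mul]
  have hGle : G.card ≤ 2 ^ (c.κ * T.card + ∑ i ∈ I, c.bits i) := by
    have hcod : Fintype.card ((T → PICOD.Msg c.κ) × ((i : I) → Fin (c.bits i) → Bool)) =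
        2 ^ (c.κ * T.card + ∑ i ∈ I, c.bits i) := by
      rw [Fintype.card_prod, Fintype.card_pi, pow_add, ← Finset.sum_coe_sort,
        ← Finset.prod_pow_eq_pow_sum]
      simp [PICOD.Msg, pow_mul]
    rw [← hcod, ← Finset.card_univ]
    refine Finset.card_le_card_of_injOn
      (fun w => (fun a : T => w a.1, fun i : I => c.codeword w i.1)) (fun _ _ => by simp) ?_
    intro w hw w' hw' hww'
    simp only [hG, Finset.coe_filter, Finset.mem_univ, true_and, Set.mem_ofPred_eq] at hw hw'
    simp only [Prod.mk.injEq] at hww'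
    exact hdet w w' hw hw' (fun a ha => congrFun hww'.1 ⟨a, ha⟩)
      (fun i hi => congrFun hww'.2 ⟨i, hi⟩)
  have hΩpos : (0 : ℝ) < Fintype.card (Fin m → PICOD.Msg c.κ) := by
    rw [hcardΩ]; positivity
  have hbad : ((Finset.univ.filter fun w => ¬ ∀ j ∈ U, c.Correct j w).card : ℝ) <
      1 / 2 * Fintype.card (Fin m → PICOD.Msg c.κ) := by
    refine lt_of_le_of_lt ?_ (mul_lt_mul_of_pos_right herr hΩpos)
    have hsub : (Finset.univ.filter fun w => ¬ ∀ j ∈ U, c.Correct j w) ⊆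
        U.biUnion fun j => Finset.univ.filter fun w => ¬ c.Correct j w := by
      intro w hw
      simpa using hw
    rw [Finset.sum_mul]
    calc ((Finset.univ.filter fun w => ¬ ∀ j ∈ U, c.Correct j w).card : ℝ)
        ≤ ∑ j ∈ U, ((Finset.univ.filter fun w => ¬ c.Correct j w).card : ℝ) := by
          exact_mod_cast (Finset.card_le_card hsub).trans Finset.card_biUnion_le
      _ = _ := by
          refine Finset.sum_congr rfl fun j _ => ?_
          unfold errorProb
          rw [div_mul_cancel₀ _ hΩpos.ne']
  have hsum := Finset.card_filter_add_card_filter_not (s := Finset.univ)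
    (fun w : Fin m → PICOD.Msg c.κ => ∀ j ∈ U, c.Correct j w)
  rw [Finset.card_univ] at hsum
  have hsum' : (G.card : ℝ) +
      ((Finset.univ.filter fun w => ¬ ∀ j ∈ U, c.Correct j w).card : ℝ) =
        Fintype.card (Fin m → PICOD.Msg c.κ) := by exact_mod_cast hsum
  have h2 : (Fintype.card (Fin m → PICOD.Msg c.κ) : ℝ) < 2 * G.card := by linarith
  have h3 : Fintype.card (Fin m → PICOD.Msg c.κ) < 2 * G.card := by exact_mod_cast h2
  rw [hcardΩ] at h3
  -- More than half of the tuples being good costs a factor below two; the strict inequality between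
  -- integer exponents absorbs it.
  have h4 : 2 ^ (c.κ * m) < 2 ^ (c.κ * T.card + ∑ i ∈ I, c.bits i + 1) := by
    rw [pow_succ]
    omega
  have := (Nat.pow_lt_pow_iff_right (by norm_num)).1 h4
  omega

end PICOD.Code

/-- Lower bound on the code-length from a set of messages with large decoding closure. -/
theorem PICOD.Achievable.le_of_card_decodingClosure {m : ℕ} {ι : Type} [Fintype ι]
    {A : ι → Finset (Fin m)} {t : ℕ} {ℓ : ℝ} (h : PICOD.Achievable A t ℓ) (k : ℕ)
    (hk : ∀ D : ι → Finset (Fin m), (∀ j, (D j).card = t) → (∀ j, Disjoint (D j) (A j)) →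
      ∃ P, P.card + k ≤ (PICOD.decodingClosure A D P).card) : (k : ℝ) ≤ ℓ := by
  classical
  -- This error level keeps the union bound over all users below `1 / 2`.
  obtain ⟨c, rfl, hc⟩ := h (1 / (2 * (Fintype.card ι + 1))) (by positivity)
  obtain ⟨P, hP⟩ := hk c.D c.D_card c.D_disjoint
  have key := c.kappa_mul_le_of_determined Finset.univ Finset.univ
    (P ∪ (PICOD.decodingClosure A c.D P)ᶜ) ?_ ?_
  · have h1 := Finset.card_union_le P (PICOD.decodingClosure A c.D P)ᶜ
    have h2 := Finset.card_add_card_compl (PICOD.decodingClosure A c.D P)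
    rw [Fintype.card_fin] at h2
    have h3 : (P ∪ (PICOD.decodingClosure A c.D P)ᶜ).card + k ≤ m := by omega
    have h4 := Nat.mul_le_mul_left c.κ h3
    rw [mul_add] at h4
    have h5 : k * c.κ ≤ ∑ i, c.bits i := by
      rw [mul_comm]; omega
    unfold PICOD.Code.length
    rw [le_div_iff₀ (by exact_mod_cast c.κ_pos)]
    exact_mod_cast h5
  · refine lt_of_le_of_lt (Finset.sum_le_sum fun j _ => hc j) ?_
    rw [Finset.sum_const, Finset.card_univ, nsmul_eq_mul, mul_one_div,
      div_lt_div_iff₀ (by positivity) (by norm_num)]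
    linarith
  · intro w w' hw hw' hT hI
    have hcl : ∀ x ∈ PICOD.decodingClosure A c.D P, w x = w' x := by
      intro x hx
      -- The indices where `w` and `w'` agree form a set closed under decoding and containing `P`.
      have := PICOD.mem_decodingClosure.1 hx (Finset.univ.filter fun x => w x = w' x) ?_ ?_
      · simpa using this
      · intro j hj d hd
        refine Finset.mem_filter.2 ⟨Finset.mem_univ _, ?_⟩
        exact (hw j (Finset.mem_univ _)).eq_of_eq (hw' j (Finset.mem_univ _))
          (fun a ha => (Finset.mem_filter.1 (hj ha)).2)
          (funext fun i => hI i (Finset.mem_univ _)) d hd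
      · intro y hy
        exact Finset.mem_filter.2 ⟨Finset.mem_univ _, hT y (Finset.mem_union_left _ hy)⟩
    funext x
    by_cases hx : x ∈ PICOD.decodingClosure A c.D P
    · exact hcl x hx
    · exact hT x (Finset.mem_union_right _ (Finset.mem_compl.2 hx))

/-- A closed `Q` with size in the gap contains some side information set `B` of size `min |Q| smax`,
hence also the `t` messages its user desires. Then `|B| + t ≤ |Q|`, which fails both for `|B| = |Q|`
and for `|B| = smax`. -/
theorem PICOD.Achievable.min_le {m t smin smax : ℕ} (ht : 0 < t) (hmin : smin ≤ smax)
    {ℓ : ℝ}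
    (h : PICOD.Achievable (PICOD.completeSideInfo m (Finset.Icc smin smax)) t ℓ) :
    ((min (smax + t) (m - smin) : ℕ) : ℝ) ≤ ℓ := by
  refine h.le_of_card_decodingClosure _ fun D hD hdisj => ?_
  have := (PICOD.decodingClosure (PICOD.completeSideInfo m (Finset.Icc smin smax))
    D).exists_card_add_le_card smin (smax + t) (by omega) ?_
  · simpa using this
  intro Q hQ
  by_contra! hcon
  obtain ⟨B, hBQ, hB⟩ : ∃ B ⊆ Q, B.card = min Q.card smax :=
    Finset.exists_subset_card_eq (min_le_left _ _)
  have hBS : B.card ∈ Finset.Icc smin smax := by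
    rw [Finset.mem_Icc]; omega
  have hDQ := PICOD.subset_of_decodingClosure_eq hQ (j := ⟨B, hBS⟩) hBQ
  have h1 := Finset.card_le_card (Finset.union_subset hDQ hBQ)
  have hdisjB : Disjoint (D ⟨B, hBS⟩) B := hdisj ⟨B, hBS⟩
  rw [Finset.card_union_of_disjoint hdisjB, hD] at h1
  omega

/-- If each user desires all the messages that it does not know, then the bits broadcast by the
other users amount to at least `t` messages. -/
theorem PICOD.Achievable.le_of_card_add_eq {m : ℕ} {ι : Type} [Fintype ι]
    {A : ι → Finset (Fin m)} {t : ℕ} {ℓ : ℝ} (h : PICOD.Achievable A t ℓ)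
    (hA : ∀ j, (A j).card + t = m) :
    (Fintype.card ι : ℝ) * t ≤ (Fintype.card ι - 1) * ℓ := by
  classical
  obtain ⟨c, rfl, hc⟩ := h (1 / 4) (by norm_num)
  have hκ : (0 : ℝ) < c.κ := by exact_mod_cast c.κ_pos
  have key : ∀ j, (c.κ : ℝ) * t + c.bits j ≤ ∑ i, c.bits i := by
    intro j
    have h1 := c.kappa_mul_le_of_determined {j} (Finset.univ.erase j) (A j) ?_ ?_
    · have h2 := Finset.add_sum_erase Finset.univ c.bits (Finset.mem_univ j)
      have h4 : c.κ * (A j).card + c.κ * t = c.κ * m := by rw [← mul_add, hA j]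
      have h3 : c.κ * t + c.bits j ≤ ∑ i, c.bits i := by omega
      exact_mod_cast h3
    · rw [Finset.sum_singleton]
      linarith [hc j]
    · intro w w' hw hw' hT hI
      have hcw : c.codeword w = c.codeword w' := by
        funext i
        by_cases hij : i = j
        · subst hij
          exact c.codeword_eq_of_eq hT
        · exact hI i (by simp [hij])
      have hD := (hw j (by simp)).eq_of_eq (hw' j (by simp)) hT hcw
      have huniv : c.D j ∪ A j = Finset.univ := by
        rw [← Finset.card_eq_iff_eq_univ, Finset.card_union_of_disjoint (c.D_disjoint j),
          c.D_card, Fintype.card_fin, add_comm, hA j]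
      funext x
      rcases Finset.mem_union.1 (huniv ▸ Finset.mem_univ x) with hx | hx
      exacts [hD x hx, hT x hx]
  have hsum := Finset.sum_le_sum fun j (_ : j ∈ Finset.univ) => key j
  simp only [Finset.sum_add_distrib, Finset.sum_const, Finset.card_univ, nsmul_eq_mul] at hsum
  unfold PICOD.Code.length
  rw [← mul_div_assoc, le_div_iff₀ hκ]
  push_cast at hsum ⊢
  linarith

/-! ### Linear schemes: systematic MDS codes -/

/-- A scheme with transmissions over a finite alphabet `F` and messages in a finite alphabet `V`,
both of size a power of two, is a zero-error code. -/
theorem PICOD.zeroErrorAchievable_of_scheme {m t : ℕ} {ι : Type} [Fintype ι]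
    {A : ι → Finset (Fin m)} {V F L : Type} [Fintype V] [Nonempty V] [Fintype F] [Fintype L]
    {κ q : ℕ} (hκ : 0 < κ) (hV : Fintype.card V = 2 ^ κ) (hF : Fintype.card F = 2 ^ q)
    (g : L → (Fin m → V) → F) (owner : L → ι)
    (hdep : ∀ l w w', (∀ a ∈ A (owner l), w a = w' a) → g l w = g l w')
    (hdec : ∀ j, ∃ D : Finset (Fin m), D.card = t ∧ Disjoint D (A j) ∧ ∀ w w' : Fin m → V,
      (∀ a ∈ A j, w a = w' a) → (∀ l, g l w = g l w') → ∀ d ∈ D, w d = w' d) :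
    PICOD.ZeroErrorAchievable A t (((q * Fintype.card L : ℕ) : ℝ) / κ) := by
  classical
  choose D hDcard hDdisj hD using hdec
  have eV : V ≃ PICOD.Msg κ := Fintype.equivOfCardEq (by simp [hV, PICOD.Msg])
  have eT : ∀ i, ({l // owner l = i} → F) ≃
      (Fin (q * Fintype.card {l // owner l = i}) → Bool) := fun i =>
    Fintype.equivOfCardEq (by simp [hF, pow_mul])
  -- Unknown messages get an arbitrary value, which is harmless since `g l` depends only on what its
  -- owner knows.
  set enc : (i : ι) → (A i → PICOD.Msg κ) →
      (Fin (q * Fintype.card {l // owner l = i}) → Bool) := fun i u =>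
    eT i fun l => g l.1 fun a =>
      if h : a ∈ A i then eV.symm (u ⟨a, h⟩) else Classical.arbitrary V with henc
  have hencg : ∀ w w' : Fin m → PICOD.Msg κ,
      (∀ i, enc i (fun a => w a.1) = enc i (fun a => w' a.1)) →
      ∀ l, g l (fun a => eV.symm (w a)) = g l (fun a => eV.symm (w' a)) := by
    intro w w' h l
    have h1 := congrFun ((eT _).injective (h (owner l))) ⟨l, rfl⟩
    have h2 : ∀ v : Fin m → PICOD.Msg κ,
        g l (fun a => if h : a ∈ A (owner l) then eV.symm (v a) else Classical.arbitrary V) =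
          g l (fun a => eV.symm (v a)) := fun v =>
      hdep l _ _ fun a ha => by simp [ha]
    rwa [h2, h2] at h1
  -- The decoder returns any tuple consistent with its data; the true tuple is one, so the default
  -- is never reached.
  refine ⟨⟨κ, hκ, fun i => q * Fintype.card {l // owner l = i}, enc, D, hDcard, hDdisj,
    fun j u b => if h : ∃ w : Fin m → PICOD.Msg κ, (∀ a : A j, w a.1 = u a) ∧
      ∀ i, enc i (fun a => w a.1) = b i then fun d => h.choose d.1 else fun _ _ => false⟩, ?_, ?_⟩
  · unfold PICOD.Code.length
    congr 2
    rw [← Finset.mul_sum]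
    congr 1
    rw [← Fintype.card_sigma]
    exact Fintype.card_congr (Equiv.sigmaFiberEquiv owner)
  · intro j w
    unfold PICOD.Code.Correct PICOD.Code.codeword
    have hex : ∃ w' : Fin m → PICOD.Msg κ, (∀ a : A j, w' a.1 = w a.1) ∧
        ∀ i, enc i (fun a => w' a.1) = enc i (fun a => w a.1) := ⟨w, fun _ => rfl, fun _ => rfl⟩
    simp only
    rw [dif_pos hex]
    funext d
    have hs := hex.choose_spec
    have := hD j (fun a => eV.symm (hex.choose a)) (fun a => eV.symm (w a))
      (fun a ha => by simp only [hs.1 ⟨a, ha⟩]) (hencg _ _ hs.2) d.1 d.2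
    exact eV.symm.injective this

/-- The basis polynomials at the nodes of `K` span the polynomials of degree below `|K|`, so the
systematic parity checks imply all Reed–Solomon ones. -/
theorem Lagrange.sum_eval_mul_eq_zero {F ι : Type*} [Field F] [DecidableEq ι] {α : ι → F}
    (hα : Function.Injective α) {K M : Finset ι} {u : ι → F}
    (hu : ∀ i ∈ K, ∑ a ∈ M, (Lagrange.basis K α i).eval (α a) * u a = 0) {p : Polynomial F}
    (hp : p.degree < K.card) : ∑ a ∈ M, p.eval (α a) * u a = 0 := by
  rw [Lagrange.eq_interpolate (s := K) (v := α) hα.injOn hp]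
  simp only [Lagrange.interpolate_apply, Polynomial.eval_finsetSum, Polynomial.eval_mul,
    Polynomial.eval_C, Finset.sum_mul]
  rw [Finset.sum_comm]
  refine Finset.sum_eq_zero fun i hi => ?_
  simp only [mul_assoc]
  rw [← Finset.mul_sum, hu i hi, mul_zero]

/-- The systematic maximum distance separable scheme on the messages in `M`, with one transmission
for each `i ∈ K`, which involves only the messages `i` and `M \ K`. -/
theorem PICOD.zeroErrorAchievable_card {m t : ℕ} {ι : Type} [Fintype ι]
    {A : ι → Finset (Fin m)} {K M : Finset (Fin m)}
    (hmiss : ∀ j, (M \ A j).card ≤ K.card) (ht : ∀ j, t ≤ (M \ A j).card)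
    (hown : ∀ i ∈ K, ∃ j, insert i (M \ K) ⊆ A j) :
    PICOD.ZeroErrorAchievable A t K.card := by
  classical
  let _ : Fintype (GaloisField 2 (m + 1)) := Fintype.ofFinite _
  have hF : Fintype.card (GaloisField 2 (m + 1)) = 2 ^ (m + 1) := by
    rw [← Nat.card_eq_fintype_card, GaloisField.card 2 (m + 1) (by omega)]
  obtain ⟨α⟩ : Nonempty (Fin m ↪ GaloisField 2 (m + 1)) :=
    Function.Embedding.nonempty_of_card_le (by
      rw [hF, Fintype.card_fin]
      exact (Nat.lt_succ_self m).le.trans Nat.lt_two_pow_self.le)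
  choose owner hown using hown
  have key := PICOD.zeroErrorAchievable_of_scheme (t := t) (A := A) (L := K) (Nat.succ_pos m) hF hF
    (fun i w => ∑ a ∈ M, (Lagrange.basis K α i.1).eval (α a) * w a) (fun i => owner i.1 i.2) ?_ ?_
  · have hm : ((m + 1 : ℕ) : ℝ) ≠ 0 := by positivity
    rw [Fintype.card_coe, Nat.cast_mul, mul_div_cancel_left₀ _ hm] at key
    exact key
  · intro i w w' h
    refine Finset.sum_congr rfl fun a ha => ?_
    by_cases haA : a ∈ A (owner i.1 i.2)
    · rw [h a haA]
    · have haK : a ∈ K := by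
        by_contra haK
        exact haA (hown i.1 i.2 (by simp [ha, haK]))
      have hai : i.1 ≠ a := fun hai => haA (hown i.1 i.2 (by simp [hai]))
      rw [Lagrange.eval_basis_of_ne hai haK, zero_mul, zero_mul]
  · intro j
    obtain ⟨D, hD, hDcard⟩ := Finset.exists_subset_card_eq (ht j)
    refine ⟨D, hDcard, Finset.disjoint_of_subset_left hD Finset.sdiff_disjoint, ?_⟩
    intro w w' hA hg d hd
    have hdM := hD hd
    have hu : ∀ i ∈ K, ∑ a ∈ M, (Lagrange.basis K α i).eval (α a) * (w a - w' a) = 0 := by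
      intro i hi
      simp only [mul_sub, Finset.sum_sub_distrib]
      exact sub_eq_zero.2 (hg ⟨i, hi⟩)
    -- Testing against the polynomial that vanishes at all the missing messages except `d` isolates
    -- the difference at `d`.
    have hdeg : (Lagrange.nodal ((M \ A j).erase d) α).degree < K.card := by
      rw [Lagrange.degree_nodal]
      exact_mod_cast (Finset.card_erase_lt_of_mem hdM).trans_le (hmiss j)
    have hsum := Lagrange.sum_eval_mul_eq_zero α.injective hu hdeg
    rw [Finset.sum_eq_single_of_mem d (Finset.mem_sdiff.1 hdM).1] at hsum
    · have hne : (Lagrange.nodal ((M \ A j).erase d) α).eval (α d) ≠ 0 := by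
        rw [Lagrange.eval_nodal, Finset.prod_ne_zero_iff]
        intro b hb
        exact sub_ne_zero.2 fun h => (Finset.ne_of_mem_erase hb) (α.injective h).symm
      exact sub_eq_zero.1 ((mul_eq_zero.1 hsum).resolve_left hne)
    · intro b hb hbd
      by_cases hbA : b ∈ A j
      · rw [hA b hbA, sub_self, mul_zero]
      · rw [Lagrange.eval_nodal_at_node (by simp [hb, hbA, hbd]), zero_mul]

theorem PICOD.exists_completeSideInfo_superset {m smin smax : ℕ} (hmin : smin ≤ smax)
    (hmax : smax ≤ m) {B : Finset (Fin m)} (hB : B.card ≤ smax) :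
    ∃ j, B ⊆ PICOD.completeSideInfo m (Finset.Icc smin smax) j := by
  obtain ⟨C, hBC, -, hC⟩ := Finset.exists_subsuperset_card_eq (Finset.subset_univ B) hB
    (by simpa using hmax)
  exact ⟨⟨C, by simp [hC, hmin]⟩, hBC⟩

/-- Forming a transmission takes one message of `K` and all of `M \ K`, hence the constraint `|M \
K| + 1 ≤ smax`. If `smax + t` is the minimum, `M = K` and messages are sent uncoded. -/
theorem PICOD.zeroErrorAchievable_min {m t smin smax : ℕ} (ht : 0 < t) (hmin : smin ≤ smax)
    (hmax : smax + t ≤ m) (hpos : 0 < smax) (hne : ¬ (smin = m - t ∧ smax = m - t)) :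
    PICOD.ZeroErrorAchievable (PICOD.completeSideInfo m (Finset.Icc smin smax)) t
      ((min (smax + t) (m - smin) : ℕ) : ℝ) := by
  classical
  have hA : ∀ j, smin ≤ (PICOD.completeSideInfo m (Finset.Icc smin smax) j).card ∧
      (PICOD.completeSideInfo m (Finset.Icc smin smax) j).card ≤ smax :=
    fun j => Finset.mem_Icc.1 j.2
  suffices h : ∃ K M : Finset (Fin m), K ⊆ M ∧ K.card = min (smax + t) (m - smin) ∧
      (∀ j, (M \ PICOD.completeSideInfo m (Finset.Icc smin smax) j).card ≤ K.card) ∧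
      smax + t ≤ M.card ∧ M.card + 1 ≤ K.card + smax by
    obtain ⟨K, M, hKM, hK, hmiss, hM, hMK⟩ := h
    rw [← hK]
    refine PICOD.zeroErrorAchievable_card hmiss (fun j => ?_) (fun i _ => ?_)
    · have := Finset.le_card_sdiff (PICOD.completeSideInfo m (Finset.Icc smin smax) j) M
      have := hA j
      omega
    · refine PICOD.exists_completeSideInfo_superset hmin (by omega) ?_
      have h1 := Finset.card_insert_le i (M \ K)
      have h2 := Finset.card_sdiff_add_card_eq_card hKM
      omega
  have hcompl : ∀ j, (PICOD.completeSideInfo m (Finset.Icc smin smax) j)ᶜ.card ≤ m - smin := by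
    intro j
    rw [Finset.card_compl, Fintype.card_fin]
    have := hA j
    omega
  have hKex : ∀ M : Finset (Fin m), ∀ k ≤ M.card, ∃ K ⊆ M, K.card = k :=
    fun M k hk => Finset.exists_subset_card_eq hk
  rcases le_total (smax + t) (m - smin) with h | h
  · obtain ⟨K, -, hK⟩ := hKex Finset.univ (smax + t) (by simpa using hmax)
    exact ⟨K, K, subset_rfl, by omega,
      fun j => Finset.card_le_card Finset.sdiff_subset, by omega, by omega⟩
  rcases hmin.lt_or_eq with hlt | rfl
  · obtain ⟨K, hKM, hK⟩ := hKex Finset.univ (m - smin) (by simp)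
    refine ⟨K, Finset.univ, hKM, by omega, fun j => ?_, by simpa using hmax, ?_⟩
    · rw [← Finset.compl_eq_univ_sdiff, hK]
      exact hcompl j
    · rw [Finset.card_univ, Fintype.card_fin, hK]
      omega
  -- With a single size, coding over all the messages would require `smin + 1` known ones, so one
  -- message is dropped. At least `smax + t` remain because `smax ≠ m - t`.
  · let x : Fin m := ⟨0, by omega⟩
    have hM : (Finset.univ.erase x).card = m - 1 := by simp
    obtain ⟨K, hKM, hK⟩ := hKex (Finset.univ.erase x) (m - smin) (by omega)
    refine ⟨K, Finset.univ.erase x, hKM, by omega, fun j => ?_, by omega, by omega⟩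
    rw [hK]
    refine (Finset.card_le_card fun y hy => ?_).trans (hcompl j)
    simpa using (Finset.mem_sdiff.1 hy).2

/-! ### The exceptional case: generic linear combinations -/

/-- For positive `n`, the slope `((s + n).choose s - 1) / n` is nondecreasing, by convexity; this
compares it at `ρ` and at `t`. It supplies Hall's condition below. -/
theorem Nat.mul_choose_add_le {s ρ t : ℕ} (hs : 0 < s) (hρ : ρ ≤ t) :
    t * (s + ρ).choose s + ρ ≤ ρ * (s + t).choose s + t := by
  obtain ⟨s, rfl⟩ := Nat.exists_eq_succ_of_ne_zero hs.ne'
  have hpascal : ∀ n, (s + 1 + (n + 1)).choose (s + 1) =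
      (s + 1 + n).choose s + (s + 1 + n).choose (s + 1) := fun n => Nat.choose_succ_succ _ _
  have hstep : ∀ n, (s + 1 + n).choose (s + 1) ≤ n * (s + 1 + n).choose s + 1 := by
    intro n
    induction n with
    | zero => simp
    | succ n ih =>
      have hmono : (s + 1 + n).choose s ≤ (s + 1 + (n + 1)).choose s :=
        Nat.choose_le_choose s (by omega)
      rw [hpascal]
      nlinarith
  induction t, hρ using Nat.le_induction with
  | base => rfl
  | succ t hρ ih =>
    rcases t.eq_zero_or_pos with rfl | ht
    · obtain rfl : ρ = 0 := by omega
      simp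
    -- The slope comparison between `t` and `t + 1`; chaining it with `ih` requires multiplying
    -- through by `t`.
    · have h1 : (t + 1) * (s + 1 + t).choose (s + 1) ≤
          t * (s + 1 + (t + 1)).choose (s + 1) + 1 := by
        rw [hpascal]
        nlinarith [hstep t]
      refine Nat.le_of_mul_le_mul_left ?_ ht
      have h2 := Nat.mul_le_mul_left (t + 1) ih
      have h3 := Nat.mul_le_mul_left ρ h1
      simp only [Nat.succ_eq_add_one] at *
      nlinarith

/-- Given a pattern of transmissions `R` and unknowns `U`, and for each user a matching of the
unknowns it misses into the transmissions, generic coefficients over a large enough field of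
characteristic two let all the users solve for the unknowns they miss. -/
theorem exists_coeff_forall_eq_zero {R U ι : Type} [Fintype R] [Fintype U] [Fintype ι]
    (supp : R → U → Prop) (W : ι → Set U) (f : (j : ι) → W j → R)
    (hf : ∀ j, Function.Injective (f j)) (hsupp : ∀ j u, supp (f j u) u.1) :
    ∃ q, 0 < q ∧ ∃ c : R → U → GaloisField 2 q, (∀ r u, ¬ supp r u → c r u = 0) ∧
      ∀ j, ∀ v : U → GaloisField 2 q, (∀ u ∉ W j, v u = 0) → (∀ r, ∑ u, c r u * v u = 0) →
        v = 0 := by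
  classical
  let M : (j : ι) → Matrix (W j) (W j) (MvPolynomial (R × U) (ZMod 2)) := fun j =>
    Matrix.of fun u u' => if supp (f j u) u'.1 then MvPolynomial.X (f j u, u'.1) else 0
  -- Setting the variables on the matching to one and the others to zero specialises the matrix to
  -- the identity.
  have hM : ∀ j, (M j).det ≠ 0 := by
    intro j h0
    have h1 : (M j).map (MvPolynomial.eval fun p => if ∃ u : W j, f j u = p.1 ∧ u.1 = p.2
        then 1 else 0) = 1 := by
      ext u u'
      simp only [M, Matrix.map_apply, Matrix.of_apply, Matrix.one_apply]
      by_cases huu : u = u'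
      · subst huu
        rw [if_pos (hsupp j u), if_pos rfl, MvPolynomial.eval_X, if_pos ⟨u, rfl, rfl⟩]
      · rw [if_neg huu]
        split_ifs
        · rw [MvPolynomial.eval_X, if_neg]
          rintro ⟨x, hx, hxu⟩
          exact huu ((hf j hx).symm.trans (Subtype.ext hxu))
        · simp
    have h2 := congrArg (MvPolynomial.eval fun p : R × U =>
      if ∃ u : W j, f j u = p.1 ∧ u.1 = p.2 then (1 : ZMod 2) else 0) h0
    rw [RingHom.map_det, RingHom.mapMatrix_apply, h1] at h2
    simp at h2
  have hP : ∏ j, (M j).det ≠ 0 := Finset.prod_ne_zero_iff.2 fun j _ => hM j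
  -- A field with `2 ^ q` elements exceeds the degree in each variable, so a common nonroot of the
  -- determinants exists.
  set q := (∏ j, (M j).det).totalDegree + 1 with hq
  refine ⟨q, by omega, ?_⟩
  let _ : Fintype (GaloisField 2 q) := Fintype.ofFinite _
  have hF : Fintype.card (GaloisField 2 q) = 2 ^ q := by
    rw [← Nat.card_eq_fintype_card, GaloisField.card 2 q (by omega)]
  obtain ⟨x, hx⟩ : ∃ x : R × U → GaloisField 2 q, MvPolynomial.eval x
      (MvPolynomial.map (algebraMap (ZMod 2) (GaloisField 2 q)) (∏ j, (M j).det)) ≠ 0 := by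
    by_contra! hcon
    have h0 := MvPolynomial.eq_zero_of_eval_zero_at_prod_finset _
      (fun _ : R × U => (Finset.univ : Finset (GaloisField 2 q))) ?_ (fun x _ => hcon x)
    · rw [← map_zero (MvPolynomial.map (algebraMap (ZMod 2) (GaloisField 2 q)))] at h0
      exact hP (MvPolynomial.map_injective _ (algebraMap (ZMod 2) (GaloisField 2 q)).injective h0)
    · intro i
      rw [Finset.card_univ, hF]
      refine lt_of_le_of_lt ?_ (Nat.lt_two_pow_self (n := q))
      rw [MvPolynomial.degreeOf_def, MvPolynomial.degrees_map_of_injective _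
        (algebraMap (ZMod 2) (GaloisField 2 q)).injective, ← MvPolynomial.degreeOf_def]
      exact (MvPolynomial.degreeOf_le_totalDegree _ _).trans (Nat.le_succ _)
  rw [map_prod, map_prod, Finset.prod_ne_zero_iff] at hx
  refine ⟨fun r u => if supp r u then x (r, u) else 0, fun r u h => if_neg h, ?_⟩
  intro j v hv hr
  have hdet := hx j (Finset.mem_univ j)
  rw [RingHom.map_det, RingHom.map_det] at hdet
  have hzero := Matrix.eq_zero_of_mulVec_eq_zero hdet (v := fun u => v u.1) ?_
  · funext u
    by_cases hu : u ∈ W j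
    · exact congrFun hzero ⟨u, hu⟩
    · exact hv u hu
  · funext u
    rw [Pi.zero_apply, ← hr (f j u), Matrix.mulVec, dotProduct]
    have hsplit := Finset.sum_subtype_of_mem (s := Finset.univ.filter (· ∈ W j)) (p := (· ∈ W j))
      (fun u' => (if supp (f j u) u' then x (f j u, u') else 0) * v u') (fun u' h => by simpa using h)
    rw [← Finset.sum_subset (Finset.subset_univ (Finset.univ.filter (· ∈ W j)))
      (fun u' _ h => by rw [hv u' (by simpa using h), mul_zero]), ← hsplit]
    refine Finset.sum_congr (by ext; simp) fun u' _ => ?_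
    congr 1
    simp only [M, RingHom.mapMatrix_apply, Matrix.map_apply, Matrix.of_apply]
    split_ifs <;> simp

namespace PICOD

theorem card_completeSideInfo_index (m s : ℕ) :
    Fintype.card {B : Finset (Fin m) // B.card ∈ Finset.Icc s s} = m.choose s := by
  rw [Fintype.card_subtype]
  simp

/-- When all side information sets have size `s = m - t`, the number of users knowing one of the
messages in `T`, where `|T| ≤ t`, is at least a fraction `|T| / t` of all the users but one. -/
theorem card_mul_le_card_filter_mul {m s t : ℕ} (hs : 0 < s) (hm : s + t = m)
    (T : Finset (Fin m)) (hT : T.card ≤ t) :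
    T.card * (m.choose s - 1) ≤
      (Finset.univ.filter fun B : {B : Finset (Fin m) // B.card ∈ Finset.Icc s s} =>
        ∃ a ∈ T, a ∈ B.1).card * t := by
  classical
  have h1 := Finset.card_filter_add_card_filter_not (s := Finset.univ)
    (fun B : {B : Finset (Fin m) // B.card ∈ Finset.Icc s s} => ∃ a ∈ T, a ∈ B.1)
  rw [Finset.card_univ, card_completeSideInfo_index] at h1
  have h2 : (Finset.univ.filter fun B : {B : Finset (Fin m) // B.card ∈ Finset.Icc s s} =>
      ¬ ∃ a ∈ T, a ∈ B.1).card ≤ (s + (t - T.card)).choose s := by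
    have hc : (Finset.powersetCard s Tᶜ).card = (s + (t - T.card)).choose s := by
      rw [Finset.card_powersetCard, Finset.card_compl, Fintype.card_fin]
      congr 1
      omega
    rw [← hc]
    refine Finset.card_le_card_of_injOn (fun B => B.1) ?_ Subtype.val_injective.injOn
    intro B hB
    have hBs := B.2
    simp only [Finset.Icc_self, Finset.mem_singleton] at hBs
    simp only [Finset.coe_filter, Finset.mem_univ, true_and, Set.mem_ofPred_eq] at hB
    refine Finset.mem_coe.2 (Finset.mem_powersetCard.2 ⟨fun a ha => ?_, hBs⟩)
    exact Finset.mem_compl.2 fun haT => hB ⟨a, haT, ha⟩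
  have h3 := Nat.mul_choose_add_le hs (Nat.sub_le t T.card)
  rw [hm] at h3
  have hpos : 0 < m.choose s := Nat.choose_pos (by omega)
  obtain ⟨N, hN⟩ := Nat.exists_eq_succ_of_ne_zero hpos.ne'
  obtain ⟨ρ, hρ⟩ := Nat.exists_eq_add_of_le hT
  have hρ' : t - T.card = ρ := by omega
  rw [hρ', hN] at h3
  rw [hρ'] at h2
  rw [hN] at h1 ⊢
  have h4 := Nat.mul_le_mul_left t h2
  simp only [Nat.succ_eq_add_one, Nat.add_sub_cancel] at *
  generalize (Finset.univ.filter fun B : {B : Finset (Fin m) // B.card ∈ Finset.Icc s s} =>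
    ∃ a ∈ T, a ∈ B.1).card = x at *
  generalize (Finset.univ.filter fun B : {B : Finset (Fin m) // B.card ∈ Finset.Icc s s} =>
    ¬ ∃ a ∈ T, a ∈ B.1).card = y at *
  have h5 : t * (x + y) = t * (N + 1) := by rw [h1]
  nlinarith

/-- Hall's condition: missed symbols drawn from a set `T` of messages number at most `|T| (N - 1)`,
while each user meeting `T` offers `t` transmissions. At most `t` messages are missed, so
`card_mul_le_card_filter_mul` applies. -/
theorem exists_matching {m s t : ℕ} (hs : 0 < s) (hm : s + t = m)
    (j : {B : Finset (Fin m) // B.card ∈ Finset.Icc s s}) :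
    ∃ f : {u : Fin m × Fin (m.choose s - 1) | u.1 ∉ j.1} →
        {B : Finset (Fin m) // B.card ∈ Finset.Icc s s} × Fin t,
      Function.Injective f ∧ ∀ u, u.1.1 ∈ (f u).1.1 := by
  classical
  refine (Fintype.all_card_le_filter_rel_iff_exists_injective
    fun (u : {u : Fin m × Fin (m.choose s - 1) | u.1 ∉ j.1})
      (r : {B : Finset (Fin m) // B.card ∈ Finset.Icc s s} × Fin t) => u.1.1 ∈ r.1.1).1 ?_
  intro Y
  set T : Finset (Fin m) := Y.image fun u => u.1.1 with hTdef
  have hTt : T.card ≤ t := by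
    have hsub : T ⊆ j.1ᶜ := by
      intro a ha
      obtain ⟨u, -, rfl⟩ := Finset.mem_image.1 ha
      exact Finset.mem_compl.2 u.2
    have hj := j.2
    simp only [Finset.Icc_self, Finset.mem_singleton] at hj
    have := Finset.card_le_card hsub
    rw [Finset.card_compl, Fintype.card_fin, hj] at this
    omega
  have hY : Y.card ≤ T.card * (m.choose s - 1) := by
    have : Y.card ≤ (T ×ˢ (Finset.univ : Finset (Fin (m.choose s - 1)))).card := by
      refine Finset.card_le_card_of_injOn (fun u => u.1) ?_ Subtype.val_injective.injOn
      intro u hu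
      exact Finset.mem_coe.2 (Finset.mem_product.2
        ⟨Finset.mem_image_of_mem _ hu, Finset.mem_univ _⟩)
    simpa using this
  refine hY.trans ((card_mul_le_card_filter_mul hs hm T hTt).trans ?_)
  rw [← Fintype.card_fin t, ← Finset.card_univ, ← Finset.card_product, Finset.card_univ,
    Fintype.card_fin]
  refine Finset.card_le_card fun r hr => ?_
  obtain ⟨a, haT, ha⟩ := (Finset.mem_filter.1 (Finset.mem_product.1 hr).1).2
  obtain ⟨u, hu, rfl⟩ := Finset.mem_image.1 haT
  exact Finset.mem_filter.2 ⟨Finset.mem_univ _, u, hu, ha⟩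

/-- `N` users send `t` symbols each, and a message has `N - 1` symbols, whence the length. -/
theorem zeroErrorAchievable_of_add_eq {m s t : ℕ} (hs : 0 < s) (ht : 0 < t) (hm : s + t = m) :
    ZeroErrorAchievable (completeSideInfo m (Finset.Icc s s)) t
      ((m.choose s : ℝ) / ((m.choose s : ℝ) - 1) * t) := by
  classical
  have hN : 1 < m.choose s := by
    have h1 : (s + 1).choose s ≤ m.choose s := Nat.choose_le_choose s (by omega)
    rw [Nat.choose_succ_self_right] at h1
    omega
  choose f hf hfs using exists_matching (t := t) hs hm
  obtain ⟨q, hq, c, hc, hdec⟩ := exists_coeff_forall_eq_zero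
    (fun (r : {B : Finset (Fin m) // B.card ∈ Finset.Icc s s} × Fin t)
      (u : Fin m × Fin (m.choose s - 1)) => u.1 ∈ r.1.1)
    (fun j : {B : Finset (Fin m) // B.card ∈ Finset.Icc s s} => {u | u.1 ∉ j.1}) f hf hfs
  let _ : Fintype (GaloisField 2 q) := Fintype.ofFinite _
  have hF : Fintype.card (GaloisField 2 q) = 2 ^ q := by
    rw [← Nat.card_eq_fintype_card, GaloisField.card 2 q hq.ne']
  have key := zeroErrorAchievable_of_scheme (t := t)
    (A := completeSideInfo m (Finset.Icc s s)) (V := Fin (m.choose s - 1) → GaloisField 2 q)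
    (κ := q * (m.choose s - 1)) (Nat.mul_pos hq (by omega)) (by simp [hF, pow_mul]) hF
    (fun r w => ∑ u : Fin m × Fin (m.choose s - 1), c r u * w u.1 u.2) (fun r => r.1) ?_ ?_
  · convert key using 1
    rw [Fintype.card_prod, card_completeSideInfo_index, Fintype.card_fin]
    have hq' : (q : ℝ) ≠ 0 := by positivity
    push_cast [Nat.cast_sub hN.le]
    have hN' : (m.choose s : ℝ) - 1 ≠ 0 := by
      have : (1 : ℝ) < m.choose s := by exact_mod_cast hN
      linarith
    field_simp
  · intro r w w' h
    refine Finset.sum_congr rfl fun u _ => ?_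
    by_cases hu : u.1 ∈ r.1.1
    · rw [h u.1 hu]
    · rw [hc r u hu, zero_mul, zero_mul]
  · intro j
    have hj : j.1.card = s := by simpa using j.2
    refine ⟨j.1ᶜ, ?_, disjoint_compl_left, fun w w' hA hg d _ => ?_⟩
    · rw [Finset.card_compl, Fintype.card_fin, hj]
      omega
    · have h0 := hdec j (fun u => w u.1 u.2 - w' u.1 u.2) ?_ ?_
      · funext k
        exact sub_eq_zero.1 (congrFun h0 (d, k))
      · intro u hu
        have hu' : u.1 ∈ j.1 := by simpa using hu
        rw [hA u.1 hu', sub_self]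
      · intro r
        simp only [mul_sub, Finset.sum_sub_distrib]
        exact sub_eq_zero.2 (hg r)

/-! ### Combination of the bounds -/

theorem ZeroErrorAchievable.achievable {m t : ℕ} {ι : Type} [Fintype ι]
    {A : ι → Finset (Fin m)} {ℓ : ℝ} (h : ZeroErrorAchievable A t ℓ) : Achievable A t ℓ := by
  obtain ⟨c, hc, hcorrect⟩ := h
  refine fun ε hε => ⟨c, hc, fun j => ?_⟩
  simp [Code.errorProb, hcorrect, hε.le]

end PICOD

theorem theorem1 (m t smin smax : ℕ) (ht : 0 < t) (hmin : smin ≤ smax) (hmax : smax + t ≤ m)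
    (hpos : 0 < smax) (ℓstar : ℝ)
    (hℓ : ℓstar =
      if smin = m - t ∧ smax = m - t then
        (m.choose (m - t) : ℝ) / ((m.choose (m - t) : ℝ) - 1) * t
      else min ((smax : ℝ) + t) ((m : ℝ) - smin)) :
    IsLeast {ℓ : ℝ | PICOD.Achievable
      (PICOD.completeSideInfo m (Finset.Icc smin smax)) t ℓ} ℓstar ∧
    IsLeast {ℓ : ℝ | PICOD.ZeroErrorAchievable
      (PICOD.completeSideInfo m (Finset.Icc smin smax)) t ℓ} ℓstar := by
  suffices h : PICOD.ZeroErrorAchievable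
      (PICOD.completeSideInfo m (Finset.Icc smin smax)) t ℓstar ∧
      ∀ ℓ, PICOD.Achievable (PICOD.completeSideInfo m (Finset.Icc smin smax)) t ℓ → ℓstar ≤ ℓ from
    ⟨⟨h.1.achievable, fun ℓ hℓ => h.2 ℓ hℓ⟩, ⟨h.1, fun ℓ hℓ => h.2 ℓ hℓ.achievable⟩⟩
  by_cases hcase : smin = m - t ∧ smax = m - t
  · rw [if_pos hcase] at hℓ
    obtain ⟨h1, h2⟩ := hcase
    rw [← h2] at hℓ
    obtain rfl : smin = smax := h1.trans h2.symm
    have hm : smin + t = m := by omega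
    subst hℓ
    refine ⟨PICOD.zeroErrorAchievable_of_add_eq hpos ht hm, fun ℓ hach => ?_⟩
    have h := hach.le_of_card_add_eq fun j => by
      have hj : j.1.card = smin := by simpa using j.2
      exact (congrArg (· + t) hj).trans hm
    rw [PICOD.card_completeSideInfo_index] at h
    have hN : (1 : ℝ) < m.choose smin := by
      have h1 : (smin + 1).choose smin ≤ m.choose smin := Nat.choose_le_choose smin (by omega)
      rw [Nat.choose_succ_self_right] at h1
      exact_mod_cast (show 1 < m.choose smin by omega)
    rw [div_mul_eq_mul_div, div_le_iff₀ (by linarith)]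
    linarith
  · rw [if_neg hcase] at hℓ
    have hcast : ℓstar = ((min (smax + t) (m - smin) : ℕ) : ℝ) := by
      rw [hℓ, Nat.cast_min, Nat.cast_sub (by omega)]
      push_cast
      rfl
    rw [hcast]
    exact ⟨PICOD.zeroErrorAchievable_min ht hmin hmax hpos hcase,
      fun ℓ hach => hach.min_le ht hmin⟩
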